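/- Let $m\ge 1$ and let $\langle\cdot,\cdot\rangle$ be the standard inner product of $\mathbb R^m$. Definitions. Let $C\subset\mathbb R^m$ be convex. A *face* of $C$ is a convex subset of $C$ that contains every closed segment in $C$ whose relative interior it meets. An *exposed face* of $C$ is either $\emptyset$ or the set of maximizers over $C$ of a linear form; it is *proper* if it is neither $\emptyset$ nor $C$. A *non-exposed face* is a face that is not an exposed face. A point $x$ is an *exposed point* (*non-exposed point*) of $C$ if $\{x\}$ is an exposed (non-exposed) face of $C$. The *normal cone* of $C$ at $x\in C$ is $N_C(x)=\{u\in\mathbb R^m : \langle u,y-x\rangle\le 0 \text{ for all } y\in C\}$; for a non-empty convex $F\subset C$, $N_C(F)$ is $N_C(x)$ for any relative interior point $x$ of $F$, and $N_C(\emptyset)=\mathbb R^m$. Let $\mathcal N_C=\{N_C(x): x\in C\}\cup\{\mathbb R^m\}$; a *proper normal cone* of $C$ is an element of $\mathcal N_C$ other than $N_C(\emptyset)$ and $N_C(C)$. If $\langle\cdot,u\rangle$ has a maximum on $C$, and $F$ is the set of its maximizers, the *touching cone* of $C$ at $u$ is the face of $N_C(F)$ that has $u$ in its relative interior; $\mathcal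 T_C$ is the set of all touching cones of $C$ together with $\mathbb R^m$. A *ray* is a set $\{tv: t\ge 0\}$ with $v\ne0$; an *exposed* (*extreme*) *ray* of a cone is a ray that is an exposed face (a face) of it. Let $\mathcal C_m^0$, $\mathcal C_m$, $\mathcal C_m'$, $\mathcal C_m''$ be the classes of convex sets $C\subset\mathbb R^m$ that have interior points and a proper exposed face, and for which every proper normal cone $N$ of $C$ satisfies, respectively: - ($\mathcal C_m^0$) $N$ has an exposed ray that belongs to $\mathcal N_C$; - ($\mathcal C_m$) $N$ has $\dim N$ linearly independent exposed rays that belong to $\mathcal N_C$; - ($\mathcal C_m'$) every extreme ray of $N$ belongs to $\mathcal N_C$; - ($\mathcal C_m''$) every non-empty face of $N$ belongs to $\mathcal N_C$. **Theorem.** Let $K\subset\mathbb R^m$ be a convex body (a compact convex set) with $0$ in its interior, and let $K^\circ=\{u\in\mathbb R^m : \langle u,x\rangle\le 1 \text{ for all } x\in K\}$ be its polar. Then 1. $K\in\mathcal C_m^0$ if and only if every proper exposed face of $K^\circ$ contains an exposed point of $K^\circ$; 2. $K\in\mathcal C_m$ if and only if every proper exposed face $F$ of $K^\circ$ contains $\dim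 F+1$ affinely independent exposed points of $K^\circ$; 3. $K\in\mathcal C_m'$ if and only if $K^\circ$ has no non-exposed points; 4. $K\in\mathcal C_m''$ if and only if $K^\circ$ has no non-exposed faces, if and only if $\mathcal N_K=\mathcal T_K$. -/

import Mathlib

namespace ConvexPolar

section General

variable {E : Type*} [NormedAddCommGroup E] [InnerProductSpace ℝ E]

/-- The normal cone of `C` at the point `x`. -/
def normalCone (C : Set E) (x : E) : Set E :=
  {u | ∀ y ∈ C, inner ℝ u (y - x) ≤ 0}

/-- The normal cone of `C` at a convex subset `F`: the normal cone of `C` at any relative interior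
point of `F` (see `normalConeOn_eq`); for `F = ∅` it is the whole space. -/
def normalConeOn (C F : Set E) : Set E :=
  {u | ∀ x ∈ intrinsicInterior ℝ F, u ∈ normalCone C x}

theorem normalConeOn_empty (C : Set E) : normalConeOn C ∅ = Set.univ := by
  ext u
  simp [normalConeOn]

/-- The normal cone at a convex subset does not depend on the relative interior point. -/
theorem normalConeOn_eq {C F : Set E} (hFC : F ⊆ C) {x : E} (hx : x ∈ intrinsicInterior ℝ F) :
    normalConeOn C F = normalCone C x := by
  refine Set.Subset.antisymm (fun u hu => hu x hx) ?_
  intro u hu x' hx' y hy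
  have hx'F : x' ∈ F := intrinsicInterior_subset hx'
  have hxF : x ∈ F := intrinsicInterior_subset hx
  obtain ⟨x₀, hx₀, rfl⟩ := hx
  -- a point of `F` slightly beyond `x₀`, seen from `x'`
  have hmemγ : ∀ t : ℝ, AffineMap.lineMap (x₀ : E) x' t ∈ affineSpan ℝ F := fun t =>
    AffineMap.lineMap_mem t x₀.2 (subset_affineSpan ℝ F hx'F)
  let γ : ℝ → affineSpan ℝ F := fun t => ⟨AffineMap.lineMap (x₀ : E) x' t, hmemγ t⟩
  have hγ : Continuous γ := AffineMap.lineMap_continuous.subtype_mk hmemγ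
  have h0 : γ 0 = x₀ := by simp [γ]
  have hnhds : ∀ᶠ t in nhds (0 : ℝ), γ t ∈ ((↑) ⁻¹' F : Set (affineSpan ℝ F)) := by
    refine hγ.continuousAt.eventually ?_
    rw [h0]
    exact mem_interior_iff_mem_nhds.mp hx₀
  obtain ⟨ε, hε, hball⟩ := Metric.eventually_nhds_iff.mp hnhds
  have hmem : AffineMap.lineMap (x₀ : E) x' (-(ε / 2)) ∈ C := by
    refine hFC (hball (y := -(ε / 2)) ?_)
    rw [Real.dist_eq, sub_zero, abs_neg, abs_of_pos (by positivity)]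
    linarith
  have h1 := hu _ hmem
  rw [AffineMap.lineMap_apply, vsub_eq_sub, vadd_eq_add, add_sub_cancel_right, inner_smul_right]
    at h1
  have h2 : 0 ≤ inner ℝ u (x' - (x₀ : E)) := by nlinarith
  have h3 := hu y hy
  have h4 : y - x' = (y - (x₀ : E)) - (x' - x₀) := by abel
  rw [h4, inner_sub_right]
  linarith

/-- The set of all normal cones of `C`: those at the points of `C`, and that at `∅`, which is the
whole space. -/
def normalCones (C : Set E) : Set (Set E) :=
  insert Set.univ {N | ∃ x ∈ C, N = normalCone C x}

/-- A normal cone of `C` that is neither the one at `∅` nor the one at `C`. -/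
def IsProperNormalCone (C N : Set E) : Prop :=
  N ∈ normalCones C ∧ N ≠ normalConeOn C ∅ ∧ N ≠ normalConeOn C C

/-- A face of `C`: a convex subset containing every closed segment in `C` whose relative interior
it meets. The empty set and `C` are faces of a convex set `C`. -/
def IsFace (C F : Set E) : Prop :=
  Convex ℝ F ∧ IsExtreme ℝ C F

/-- An exposed face (`IsExposed ℝ C F`: `F` is empty or the set of maximizers of a linear form
on `C`) other than `∅` and `C`. -/
def IsProperExposedFace (C F : Set E) : Prop :=
  IsExposed ℝ C F ∧ F ≠ ∅ ∧ F ≠ C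

/-- A face that is not an exposed face. -/
def IsNonExposedFace (C F : Set E) : Prop :=
  IsFace C F ∧ ¬ IsExposed ℝ C F

/-- A point whose singleton is a non-exposed face. -/
def IsNonExposedPoint (C : Set E) (x : E) : Prop :=
  IsNonExposedFace C {x}

/-- The ray from the origin in direction `v`. -/
def ray (v : E) : Set E :=
  {x | ∃ t : ℝ, 0 ≤ t ∧ x = t • v}

/-- A ray (from the origin): the nonnegative multiples of a nonzero vector. -/
def IsRay (R : Set E) : Prop :=
  ∃ v : E, v ≠ 0 ∧ R = ray v

/-- The dimension of a nonempty convex set: the dimension of its affine hull. -/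
noncomputable def convexDim (C : Set E) : ℕ :=
  Module.finrank ℝ (vectorSpan ℝ C)

/-- A convex set with interior points that has a proper exposed face. -/
def IsProperConvexSubset (C : Set E) : Prop :=
  Convex ℝ C ∧ (interior C).Nonempty ∧ ∃ F, IsProperExposedFace C F

/-- The exposed face of the maximizers over `C` of the inner product with `u`. -/
def argmaxFace (C : Set E) (u : E) : Set E :=
  {x ∈ C | ∀ y ∈ C, inner ℝ y u ≤ inner ℝ x u}

/-- `T` is the touching cone of `C` at `u`, where the inner product with `u` has a maximum on `C`:
the face of the normal cone at the set of maximizers that has `u` in its relative interior. -/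
def IsTouchingConeAt (C : Set E) (u : E) (T : Set E) : Prop :=
  (argmaxFace C u).Nonempty ∧ IsFace (normalConeOn C (argmaxFace C u)) T ∧
    u ∈ intrinsicInterior ℝ T

/-- The set of touching cones of `C`; it contains the whole space, the normal cone at `∅`, by
definition. -/
def touchingCones (C : Set E) : Set (Set E) :=
  insert Set.univ {T | ∃ u, IsTouchingConeAt C u T}

/-- The (one-sided) polar of `K`. -/
def polarSet (K : Set E) : Set E :=
  {u | ∀ x ∈ K, inner ℝ u x ≤ 1}

end General

/-- The class `𝒞_m^0`: every proper normal cone has an exposed ray that is a normal cone. -/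
def classC0 (m : ℕ) : Set (Set (EuclideanSpace ℝ (Fin m))) :=
  {C | IsProperConvexSubset C ∧ ∀ N, IsProperNormalCone C N →
    ∃ R, IsRay R ∧ IsExposed ℝ N R ∧ R ∈ normalCones C}

/-- The class `𝒞_m`: every proper normal cone `N` has `dim N` linearly independent exposed rays
that are normal cones. -/
def classC (m : ℕ) : Set (Set (EuclideanSpace ℝ (Fin m))) :=
  {C | IsProperConvexSubset C ∧ ∀ N, IsProperNormalCone C N →
    ∃ v : Fin (convexDim N) → EuclideanSpace ℝ (Fin m), LinearIndependent ℝ v ∧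
      ∀ i, IsExposed ℝ N (ray (v i)) ∧ ray (v i) ∈ normalCones C}

/-- The class `𝒞_m'`: every extreme ray of every proper normal cone is a normal cone. -/
def classC' (m : ℕ) : Set (Set (EuclideanSpace ℝ (Fin m))) :=
  {C | IsProperConvexSubset C ∧ ∀ N, IsProperNormalCone C N →
    ∀ R, IsRay R → IsFace N R → R ∈ normalCones C}

/-- The class `𝒞_m''`: every nonempty face of every proper normal cone is a normal cone. -/
def classC'' (m : ℕ) : Set (Set (EuclideanSpace ℝ (Fin m))) :=
  {C | IsProperConvexSubset C ∧ ∀ N, IsProperNormalCone C N →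
    ∀ T, T.Nonempty → IsFace N T → T ∈ normalCones C}

end ConvexPolar

open ConvexPolar

/-!
Everything is read off from a dictionary between the normal cones of `K` and the exposed faces of
its polar `P`. For `x ∈ K` put `polarFace K x = {u ∈ P | ⟪u, x⟫ = 1}`. Since `0` is interior to `K`,
a nonzero `u` in the normal cone at `x` has `⟪u, x⟫ > 0`, hence is a positive multiple of an element
of `polarFace K x`: the normal cone at `x` is the cone over `polarFace K x`, or `{0}` if that set is
empty (`normalCone_eq_coneOver`, `normalCone_eq_zero`). By the bipolar theorem the sets
`polarFace K x` with `x ∈ K` that are nonempty are exactly the proper exposed faces of `P`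
(`isProperExposedFace_polarSet_iff`), so the proper normal cones of `K` are the cones over the
proper exposed faces of `P`.

Each `polarFace K x` lies in a hyperplane off the origin. Therefore taking cones is a bijection from
its nonempty faces to the faces other than `∅` and `{0}` of the cone (`isFace_coneOver_iff`,
`IsFace.eq_coneOver_inter`), raises the dimension by one, and turns affine into linear independence.
A part `G` of it is an exposed face of `P` iff the cone over `G` is a normal cone of `K`
(`coneOver_mem_normalCones_iff`). Two more facts match the two sides: a normal cone contained in
another one is an exposed face of it (`isExposed_normalCone`), and a nonempty face of `P` other than
`P` lies in some `polarFace K x` (`IsFace.exists_subset_polarFace`).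

As to touching cones, apart from the whole space they are the nonempty faces of the normal cones at
points (`mem_touchingCones_iff`), so that equality of the touching and the normal cones says
that nonempty faces of normal cones are normal cones.
-/

namespace ConvexPolar

variable {E : Type*} [NormedAddCommGroup E] [InnerProductSpace ℝ E]

/-! ### The cone over a set -/

/-- The cone over `G`: all nonnegative multiples of elements of `G`. It contains the origin as soon
as `G` is nonempty, and is empty if `G` is. -/
def coneOver (G : Set E) : Set E :=
  {w | ∃ t : ℝ, 0 ≤ t ∧ ∃ u ∈ G, w = t • u}

theorem ray_eq_coneOver (v : E) : ray v = coneOver {v} := by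
  ext w
  simp [ray, coneOver]

theorem subset_coneOver (G : Set E) : G ⊆ coneOver G :=
  fun u hu => ⟨1, zero_le_one, u, hu, (one_smul ℝ u).symm⟩

theorem coneOver_mono {G F : Set E} (h : G ⊆ F) : coneOver G ⊆ coneOver F := by
  rintro _ ⟨t, ht, u, hu, rfl⟩
  exact ⟨t, ht, u, h hu, rfl⟩

theorem zero_mem_coneOver {G : Set E} (h : G.Nonempty) : (0 : E) ∈ coneOver G := by
  obtain ⟨u, hu⟩ := h
  exact ⟨0, le_rfl, u, hu, (zero_smul ℝ u).symm⟩

theorem smul_mem_coneOver {G : Set E} {s : ℝ} (hs : 0 ≤ s) {w : E} (hw : w ∈ coneOver G) :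
    s • w ∈ coneOver G := by
  obtain ⟨t, ht, u, hu, rfl⟩ := hw
  exact ⟨s * t, mul_nonneg hs ht, u, hu, smul_smul s t u⟩

theorem ray_smul {t : ℝ} (ht : 0 < t) (p : E) : ray (t • p) = ray p := by
  rw [ray_eq_coneOver, ray_eq_coneOver]
  refine Set.Subset.antisymm ?_ ?_
  · rintro _ ⟨s, hs, _, rfl, rfl⟩
    exact ⟨s * t, by positivity, p, rfl, smul_smul s t p⟩
  · rintro _ ⟨s, hs, _, rfl, rfl⟩
    refine ⟨s * t⁻¹, by positivity, _, rfl, ?_⟩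
    rw [smul_smul, inv_mul_cancel_right₀ ht.ne']

theorem convex_coneOver {G : Set E} (hG : Convex ℝ G) : Convex ℝ (coneOver G) := by
  rintro _ ⟨t₁, ht₁, u₁, hu₁, rfl⟩ _ ⟨t₂, ht₂, u₂, hu₂, rfl⟩ a b ha hb -
  have h₁ : 0 ≤ a * t₁ := mul_nonneg ha ht₁
  have h₂ : 0 ≤ b * t₂ := mul_nonneg hb ht₂
  rcases (add_nonneg h₁ h₂).eq_or_lt with h | h
  · have e₁ : a * t₁ = 0 := by linarith
    have e₂ : b * t₂ = 0 := by linarith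
    refine ⟨0, le_rfl, u₁, hu₁, ?_⟩
    rw [smul_smul, smul_smul, e₁, e₂]
    simp
  · refine ⟨a * t₁ + b * t₂, h.le, (a * t₁ / (a * t₁ + b * t₂)) • u₁ +
      (b * t₂ / (a * t₁ + b * t₂)) • u₂, hG hu₁ hu₂ (by positivity) (by positivity) ?_, ?_⟩
    · rw [← add_div, div_self h.ne']
    · rw [smul_add, smul_smul, smul_smul, smul_smul, smul_smul, mul_div_cancel₀ _ h.ne',
        mul_div_cancel₀ _ h.ne']

/-- A set in the affine hyperplane `⟪·, x⟫ = 1` is recovered from the cone over it as a slice. -/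
theorem mem_of_mem_coneOver {G : Set E} {x : E} (hG : ∀ g ∈ G, inner ℝ g x = 1) {u : E}
    (hu : u ∈ coneOver G) (hux : inner ℝ u x = 1) : u ∈ G := by
  obtain ⟨t, -, g, hg, rfl⟩ := hu
  rw [real_inner_smul_left, hG g hg, mul_one] at hux
  rwa [hux, one_smul]

theorem inner_nonneg_of_mem_coneOver {G : Set E} {x : E} (hG : ∀ g ∈ G, inner ℝ g x = 1) {u : E}
    (hu : u ∈ coneOver G) : 0 ≤ inner ℝ u x := by
  obtain ⟨t, ht, g, hg, rfl⟩ := hu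
  rw [real_inner_smul_left, hG g hg, mul_one]
  exact ht

theorem coneOver_ne_univ {G : Set E} {x : E} (hG : ∀ g ∈ G, inner ℝ g x = 1)
    (hne : G.Nonempty) : coneOver G ≠ Set.univ := by
  intro h
  obtain ⟨g, hg⟩ := hne
  have h1 := inner_nonneg_of_mem_coneOver hG (h ▸ Set.mem_univ (-g) : -g ∈ coneOver G)
  rw [inner_neg_left, hG g hg] at h1
  linarith

/-- The cone over a face is a face of the cone, for sets in a hyperplane off the origin. -/
theorem isFace_coneOver {F G : Set E} {x : E} (hF : ∀ f ∈ F, inner ℝ f x = 1)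
    (hG : IsFace F G) (hne : G.Nonempty) : IsFace (coneOver F) (coneOver G) := by
  refine ⟨convex_coneOver hG.1, coneOver_mono hG.2.subset, ?_⟩
  rintro _ ⟨t₁, ht₁, u₁, hu₁, rfl⟩ _ ⟨t₂, ht₂, u₂, hu₂, rfl⟩ _ ⟨s, -, g, hg, rfl⟩
    ⟨a, b, ha, hb, -, hw⟩
  rcases ht₁.eq_or_lt with rfl | ht₁
  · rw [zero_smul]
    exact zero_mem_coneOver hne
  refine ⟨t₁, ht₁.le, u₁, ?_, rfl⟩
  -- comparing the values of `⟪·, x⟫` shows that `g` is a convex combination of `u₁` and `u₂`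
  have hs : a * t₁ + b * t₂ = s := by
    have h := congrArg (fun z => inner ℝ z x) hw
    simpa [inner_add_left, real_inner_smul_left, hF _ hu₁, hF _ hu₂, hF _ (hG.2.subset hg)]
      using h
  have h₁ : 0 < a * t₁ := mul_pos ha ht₁
  have h₂ : 0 ≤ b * t₂ := mul_nonneg hb.le ht₂
  have hs0 : 0 < s := by linarith
  have hg' : g = (a * t₁ / s) • u₁ + (b * t₂ / s) • u₂ := by
    have h := congrArg (fun z => s⁻¹ • z) hw
    simp only [smul_add, smul_smul, inv_mul_cancel₀ hs0.ne', one_smul] at h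
    rw [← h, div_eq_inv_mul, div_eq_inv_mul]
  rcases ht₂.eq_or_lt with rfl | ht₂
  · rw [mul_zero, add_zero] at hs
    rw [mul_zero, zero_div, zero_smul, add_zero, hs, div_self hs0.ne', one_smul] at hg'
    exact hg' ▸ hg
  · refine hG.2.left_mem_of_mem_openSegment hu₁ hu₂ hg
      ⟨a * t₁ / s, b * t₂ / s, by positivity, by positivity, ?_, hg'.symm⟩
    rw [← add_div, hs, div_self hs0.ne']

/-- A face of a convex set in a hyperplane off the origin is detected on the cones. -/
theorem IsFace.of_coneOver {F G : Set E} {x : E} (hF : ∀ f ∈ F, inner ℝ f x = 1)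
    (hFc : Convex ℝ F) (hGF : G ⊆ F) (h : IsFace (coneOver F) (coneOver G)) :
    IsFace F G := by
  have hG : ∀ g ∈ G, inner ℝ g x = 1 := fun g hg => hF g (hGF hg)
  refine ⟨fun u hu v hv a b ha hb hab => ?_, hGF, fun u hu v hv w hw hwuv => ?_⟩
  · exact mem_of_mem_coneOver hG (h.1 (subset_coneOver G hu) (subset_coneOver G hv) ha hb hab)
      (hF _ (hFc (hGF hu) (hGF hv) ha hb hab))
  · exact mem_of_mem_coneOver hG (h.2.left_mem_of_mem_openSegment (subset_coneOver F hu)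
      (subset_coneOver F hv) (subset_coneOver G hw) hwuv) (hF u hu)

/-- A nonempty face of a cone is closed under multiplication by nonnegative scalars. -/
theorem IsFace.smul_mem {F T : Set E} (hT : IsFace (coneOver F) T) {w : E} (hw : w ∈ T)
    {t : ℝ} (ht : 0 ≤ t) : t • w ∈ T := by
  have hwF := hT.2.subset hw
  have h0F : (0 : E) ∈ coneOver F := by simpa using smul_mem_coneOver le_rfl hwF
  -- `w` lies strictly between `0` and `(t + 2) • w`
  have hseg : w ∈ openSegment ℝ (0 : E) ((t + 2) • w) := by
    refine ⟨1 - (t + 2)⁻¹, (t + 2)⁻¹, ?_, by positivity, by ring, ?_⟩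
    · have : (t + 2)⁻¹ < 1 := inv_lt_one_of_one_lt₀ (by linarith)
      linarith
    · rw [smul_zero, zero_add, smul_smul, inv_mul_cancel₀ (by positivity), one_smul]
  have hbig := smul_mem_coneOver (s := t + 2) (by positivity) hwF
  have h0 := hT.2.left_mem_of_mem_openSegment h0F hbig hw hseg
  have h1 := hT.2.right_mem_of_mem_openSegment h0F hbig hw hseg
  have ha : 0 ≤ 1 - t / (t + 2) := by
    rw [sub_nonneg]
    exact div_le_one_of_le₀ (by linarith) (by linarith)
  have hb : 0 ≤ t / (t + 2) := by positivity
  have h2 := hT.1 h0 h1 ha hb (sub_add_cancel 1 _)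
  rwa [smul_zero, zero_add, smul_smul, div_mul_cancel₀ _ (by positivity)] at h2

theorem IsFace.eq_coneOver_inter {F T : Set E} (hT : IsFace (coneOver F) T)
    (hne : (T ∩ F).Nonempty) : T = coneOver (T ∩ F) := by
  refine Set.Subset.antisymm (fun w hw => ?_) ?_
  · obtain ⟨t, ht, u, hu, rfl⟩ := hT.2.subset hw
    rcases ht.eq_or_lt with rfl | ht
    · rw [zero_smul]
      exact zero_mem_coneOver hne
    · refine ⟨t, ht.le, u, ⟨?_, hu⟩, rfl⟩
      have := hT.smul_mem hw (inv_nonneg.2 ht.le)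
      rwa [smul_smul, inv_mul_cancel₀ ht.ne', one_smul] at this
  · rintro _ ⟨t, ht, u, hu, rfl⟩
    exact hT.smul_mem hu.1 ht

theorem IsFace.eq_zero_or_inter_nonempty {F T : Set E} (hT : IsFace (coneOver F) T)
    (hne : T.Nonempty) : T = {0} ∨ (T ∩ F).Nonempty := by
  by_cases h : ∃ w ∈ T, w ≠ 0
  · right
    obtain ⟨w, hw, hw0⟩ := h
    obtain ⟨t, ht, u, hu, rfl⟩ := hT.2.subset hw
    have ht' : t ≠ 0 := by
      rintro rfl
      exact hw0 (zero_smul ℝ u)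
    refine ⟨u, ?_, hu⟩
    have := hT.smul_mem hw (inv_nonneg.2 ht)
    rwa [smul_smul, inv_mul_cancel₀ ht', one_smul] at this
  · push Not at h
    exact Or.inl (Set.eq_singleton_iff_nonempty_unique_mem.2 ⟨hne, h⟩)

/-! ### Dimension of a cone and independence in a hyperplane -/

theorem vectorSpan_coneOver {F : Set E} (hne : F.Nonempty) :
    vectorSpan ℝ (coneOver F) = Submodule.span ℝ F := by
  rw [vectorSpan_eq_span_vsub_set_right ℝ (zero_mem_coneOver hne)]
  simp only [vsub_eq_sub, sub_zero, Set.image_id']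
  refine le_antisymm (Submodule.span_le.2 ?_) (Submodule.span_mono (subset_coneOver F))
  rintro _ ⟨t, -, u, hu, rfl⟩
  exact Submodule.smul_mem _ _ (Submodule.subset_span hu)

/-- The cone over a set in a hyperplane off the origin has one dimension more than the set. -/
theorem convexDim_coneOver [FiniteDimensional ℝ E] {F : Set E} {x : E}
    (hF : ∀ f ∈ F, inner ℝ f x = 1) (hne : F.Nonempty) :
    convexDim (coneOver F) = convexDim F + 1 := by
  obtain ⟨u, hu⟩ := hne
  have hu0 : u ≠ 0 := by
    rintro rfl
    simpa using hF 0 hu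
  have hsup : Submodule.span ℝ F = vectorSpan ℝ F ⊔ Submodule.span ℝ {u} := by
    refine le_antisymm (Submodule.span_le.2 fun f hf => ?_) (sup_le ?_ ?_)
    · rw [← sub_add_cancel f u]
      exact Submodule.add_mem_sup (vsub_mem_vectorSpan ℝ hf hu) (Submodule.mem_span_singleton_self u)
    · rw [vectorSpan_eq_span_vsub_set_right ℝ hu, Submodule.span_le]
      rintro _ ⟨f, hf, rfl⟩
      exact Submodule.sub_mem _ (Submodule.subset_span hf) (Submodule.subset_span hu)
    · exact Submodule.span_mono (Set.singleton_subset_iff.2 hu)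
  -- directions of `F` are orthogonal to `x`, while `u` is not
  have hinf : vectorSpan ℝ F ⊓ Submodule.span ℝ {u} = ⊥ := by
    have hker : vectorSpan ℝ F ≤ LinearMap.ker (innerₗ E x) := by
      rw [vectorSpan_eq_span_vsub_set_right ℝ hu, Submodule.span_le]
      rintro _ ⟨f, hf, rfl⟩
      simp only [SetLike.mem_coe, LinearMap.mem_ker, innerₗ_apply_apply, vsub_eq_sub]
      rw [real_inner_comm, inner_sub_left, hF f hf, hF u hu, sub_self]
    rw [eq_bot_iff]
    rintro w ⟨hw, hwu⟩
    obtain ⟨t, rfl⟩ := Submodule.mem_span_singleton.1 hwu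
    have h := hker hw
    rw [LinearMap.mem_ker, innerₗ_apply_apply, real_inner_comm, real_inner_smul_left, hF u hu,
      mul_one] at h
    simp [h]
  have hfin := Submodule.finrank_sup_add_finrank_inf_eq (vectorSpan ℝ F) (Submodule.span ℝ {u})
  rw [hinf, finrank_bot, add_zero, finrank_span_singleton hu0] at hfin
  rw [convexDim, convexDim, vectorSpan_coneOver ⟨u, hu⟩, hsup, hfin]

/-- In a hyperplane off the origin, affine and linear independence agree. -/
theorem affineIndependent_iff_linearIndependent_of_inner_eq_one {ι : Type*} {p : ι → E} {x : E}
    (hp : ∀ i, inner ℝ (p i) x = 1) : AffineIndependent ℝ p ↔ LinearIndependent ℝ p := by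
  rw [affineIndependent_iff, linearIndependent_iff']
  refine ⟨fun h s w hw => h s w ?_ hw, fun h s w _ hw => h s w hw⟩
  have := congrArg (fun z => inner ℝ z x) hw
  simpa [sum_inner, real_inner_smul_left, hp] using this

/-! ### Normal cones and faces of normal cones -/

theorem convex_normalCone (C : Set E) (x : E) : Convex ℝ (normalCone C x) := by
  intro u hu v hv a b ha hb _ y hy
  rw [inner_add_left, real_inner_smul_left, real_inner_smul_left]
  have h₁ := mul_nonpos_of_nonneg_of_nonpos ha (hu y hy)
  have h₂ := mul_nonpos_of_nonneg_of_nonpos hb (hv y hy)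
  linarith

/-- A normal cone contained in another one is an exposed face of it: the difference of the base
points exposes it. -/
theorem isExposed_normalCone {C : Set E} {x y : E} (hx : x ∈ C) (hy : y ∈ C)
    (h : normalCone C y ⊆ normalCone C x) : IsExposed ℝ (normalCone C x) (normalCone C y) := by
  intro _
  refine ⟨innerSL ℝ (y - x), ?_⟩
  simp only [innerSL_apply_apply]
  ext u
  constructor
  · intro hu
    refine ⟨h hu, fun v hv => ?_⟩
    have h₁ := hv y hy
    have h₂ := hu x hx
    rw [← neg_sub, inner_neg_right] at h₂
    rw [real_inner_comm, real_inner_comm u]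
    linarith
  · rintro ⟨hu, hmax⟩ z hz
    have h₁ : 0 ≤ inner ℝ u (y - x) := by
      have := hmax 0 (by intro z _; simp)
      rwa [inner_zero_right, real_inner_comm] at this
    have h₂ := hu z hz
    have h₃ : z - y = (z - x) - (y - x) := by abel
    rw [h₃, inner_sub_right]
    linarith

/-- A convex set extends a little beyond any of its relative interior points. -/
theorem exists_lineMap_neg_mem {F : Set E} {z w : E} (hz : z ∈ intrinsicInterior ℝ F)
    (hw : w ∈ F) : ∃ ε : ℝ, 0 < ε ∧ z - ε • (w - z) ∈ F := by
  obtain ⟨z₀, hz₀, rfl⟩ := hz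
  have hmemγ : ∀ t : ℝ, AffineMap.lineMap (z₀ : E) w t ∈ affineSpan ℝ F := fun t =>
    AffineMap.lineMap_mem t z₀.2 (subset_affineSpan ℝ F hw)
  let γ : ℝ → affineSpan ℝ F := fun t => ⟨AffineMap.lineMap (z₀ : E) w t, hmemγ t⟩
  have hγ : Continuous γ := AffineMap.lineMap_continuous.subtype_mk hmemγ
  have h0 : γ 0 = z₀ := by simp [γ]
  have hnhds : ∀ᶠ t in nhds (0 : ℝ), γ t ∈ ((↑) ⁻¹' F : Set (affineSpan ℝ F)) := by
    refine hγ.continuousAt.eventually ?_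
    rw [h0]
    exact mem_interior_iff_mem_nhds.mp hz₀
  obtain ⟨ε, hε, hball⟩ := Metric.eventually_nhds_iff.mp hnhds
  refine ⟨ε / 2, by positivity, ?_⟩
  have hmem : AffineMap.lineMap (z₀ : E) w (-(ε / 2)) ∈ F := by
    refine hball (y := -(ε / 2)) ?_
    rw [Real.dist_eq, sub_zero, abs_neg, abs_of_pos (by positivity)]
    linarith
  rwa [AffineMap.lineMap_apply, vsub_eq_sub, vadd_eq_add, neg_smul, neg_add_eq_sub] at hmem

/-- A linear form that attains its maximum over a set at a relative interior point is constant. -/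
theorem inner_eq_of_mem_intrinsicInterior {F : Set E} {z a : E}
    (hz : z ∈ intrinsicInterior ℝ F) (hmax : ∀ y ∈ F, inner ℝ a y ≤ inner ℝ a z) {w : E}
    (hw : w ∈ F) : inner ℝ a w = inner ℝ a z := by
  obtain ⟨ε, hε, hmem⟩ := exists_lineMap_neg_mem hz hw
  have h₁ := hmax w hw
  have h₂ := hmax _ hmem
  rw [inner_sub_right, real_inner_smul_right, inner_sub_right] at h₂
  nlinarith

theorem convex_argmaxFace {C : Set E} (hC : Convex ℝ C) (u : E) : Convex ℝ (argmaxFace C u) := by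
  intro x hx y hy a b ha hb hab
  refine ⟨hC hx.1 hy.1 ha hb hab, fun z hz => ?_⟩
  rw [inner_add_left, real_inner_smul_left, real_inner_smul_left]
  have h₁ := mul_le_mul_of_nonneg_left (hx.2 z hz) ha
  have h₂ := mul_le_mul_of_nonneg_left (hy.2 z hz) hb
  have h₃ : inner ℝ z u = a * inner ℝ z u + b * inner ℝ z u := by rw [← add_mul, hab, one_mul]
  linarith

theorem mem_argmaxFace_iff {C : Set E} {x u : E} (hx : x ∈ C) :
    x ∈ argmaxFace C u ↔ u ∈ normalCone C x := by
  refine ⟨fun h y hy => ?_, fun h => ⟨hx, fun y hy => ?_⟩⟩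
  · have := h.2 y hy
    rw [inner_sub_right, real_inner_comm, real_inner_comm x]
    linarith
  · have := h y hy
    rw [inner_sub_right, real_inner_comm, real_inner_comm x] at this
    linarith

theorem IsTouchingConeAt.exists_isFace [FiniteDimensional ℝ E] {C : Set E} (hC : Convex ℝ C)
    {u : E} {T : Set E} (h : IsTouchingConeAt C u T) :
    T.Nonempty ∧ ∃ x ∈ C, IsFace (normalCone C x) T := by
  obtain ⟨hne, hT, hu⟩ := h
  obtain ⟨z, hz⟩ := hne.intrinsicInterior (convex_argmaxFace hC u)
  rw [normalConeOn_eq (fun _ h => h.1) hz] at hT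
  exact ⟨⟨u, intrinsicInterior_subset hu⟩, z, (intrinsicInterior_subset hz).1, hT⟩

/-- A nonempty face of a normal cone is a touching cone at any of its relative interior points:
the normal cone at the maximizers of such a point lies between the face and the cone. -/
theorem IsFace.exists_isTouchingConeAt [FiniteDimensional ℝ E] {C : Set E} (hC : Convex ℝ C)
    {x : E} (hx : x ∈ C) {T : Set E} (hT : IsFace (normalCone C x) T) (hne : T.Nonempty) :
    ∃ u, IsTouchingConeAt C u T := by
  obtain ⟨u, hu⟩ := hne.intrinsicInterior hT.1
  have hxF : x ∈ argmaxFace C u :=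
    (mem_argmaxFace_iff hx).2 (hT.2.subset (intrinsicInterior_subset hu))
  obtain ⟨z, hz⟩ := Set.Nonempty.intrinsicInterior (convex_argmaxFace hC u) ⟨x, hxF⟩
  have hzF := intrinsicInterior_subset hz
  refine ⟨u, ⟨x, hxF⟩, ?_, hu⟩
  rw [normalConeOn_eq (fun _ h => h.1) hz]
  have hle : normalCone C z ⊆ normalCone C x := by
    intro v hv
    refine (mem_argmaxFace_iff hx).1 ⟨hx, fun y hy => ?_⟩
    have h₁ : inner ℝ v x = inner ℝ v z := inner_eq_of_mem_intrinsicInterior hz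
      (fun y hy => by
        have := hv y hy.1
        rw [inner_sub_right] at this
        linarith) hxF
    rw [real_inner_comm, real_inner_comm v x, h₁]
    have := hv y hy
    rw [inner_sub_right] at this
    linarith
  refine ⟨hT.1, hT.2.mono hle fun w hw => ?_⟩
  -- `⟪·, z - x⟫` is nonpositive on `T` and vanishes at the relative interior point `u`
  have hw0 : inner ℝ (z - x) w = inner ℝ (z - x) u := by
    refine inner_eq_of_mem_intrinsicInterior hu (fun y hy => ?_) hw
    have h₁ := hT.2.subset hy z hzF.1
    have h₂ := hzF.2 x hx
    rw [real_inner_comm, inner_sub_left]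
    linarith
  have h₁ := hxF.2 z hzF.1
  have h₂ := hzF.2 x hx
  rw [inner_sub_left _ _ u, le_antisymm h₁ h₂, sub_self, real_inner_comm] at hw0
  intro y hy
  have h₃ := hT.2.subset hw y hy
  rw [← sub_sub_sub_cancel_right y z x, inner_sub_right, hw0, sub_zero]
  exact h₃

/-- The touching cones are the whole space and the nonempty faces of the normal cones at points. -/
theorem mem_touchingCones_iff [FiniteDimensional ℝ E] {C : Set E} (hC : Convex ℝ C) {T : Set E} :
    T ∈ touchingCones C ↔
      T = Set.univ ∨ T.Nonempty ∧ ∃ x ∈ C, IsFace (normalCone C x) T := by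
  refine or_congr_right ⟨?_, ?_⟩
  · rintro ⟨u, hu⟩
    exact hu.exists_isFace hC
  · rintro ⟨hne, x, hx, hT⟩
    exact hT.exists_isTouchingConeAt hC hx hne

theorem normalCones_subset_touchingCones [FiniteDimensional ℝ E] {C : Set E} (hC : Convex ℝ C) :
    normalCones C ⊆ touchingCones C := by
  rintro N hN
  rw [mem_touchingCones_iff hC]
  refine hN.imp id ?_
  rintro ⟨x, hx, rfl⟩
  exact ⟨⟨0, fun y _ => by simp⟩, x, hx, convex_normalCone C x, IsExtreme.refl ℝ _⟩

/-! ### The polar body and its exposed faces -/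

/-- The exposed face of the polar of `K` cut out by the point `x ∈ K`; it is nonempty only if `x` is
a boundary point of `K`. -/
def polarFace (K : Set E) (x : E) : Set E :=
  {u ∈ polarSet K | inner ℝ u x = 1}

theorem inner_eq_one_of_mem_polarFace {K : Set E} {x : E} :
    ∀ u ∈ polarFace K x, inner ℝ u x = 1 := fun _ hu => hu.2

theorem exists_pos_smul_mem {C : Set E} (h0 : (0 : E) ∈ interior C) (w : E) :
    ∃ ε : ℝ, 0 < ε ∧ ε • w ∈ C := by
  have hc : Continuous fun t : ℝ => t • w := by fun_prop
  have hev : ∀ᶠ t : ℝ in nhds 0, t • w ∈ C := by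
    refine hc.continuousAt.eventually ?_
    simpa using mem_interior_iff_mem_nhds.1 h0
  obtain ⟨δ, hδ, h⟩ := Metric.eventually_nhds_iff.1 hev
  refine ⟨δ / 2, by positivity, h ?_⟩
  rw [Real.dist_eq, sub_zero, abs_of_pos (by positivity)]
  linarith

theorem convex_polarSet (K : Set E) : Convex ℝ (polarSet K) := by
  intro u hu v hv a b ha hb hab x hx
  rw [inner_add_left, real_inner_smul_left, real_inner_smul_left]
  have h₁ := mul_le_mul_of_nonneg_left (hu x hx) ha
  have h₂ := mul_le_mul_of_nonneg_left (hv x hx) hb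
  linarith

theorem zero_mem_interior_polarSet {K : Set E} (hK : Bornology.IsBounded K) :
    (0 : E) ∈ interior (polarSet K) := by
  obtain ⟨R, hR, hKR⟩ := hK.exists_pos_norm_le
  rw [mem_interior_iff_mem_nhds, Metric.mem_nhds_iff]
  refine ⟨R⁻¹, by positivity, fun u hu x hx => ?_⟩
  rw [mem_ball_zero_iff] at hu
  calc inner ℝ u x ≤ ‖u‖ * ‖x‖ := real_inner_le_norm u x
    _ ≤ R⁻¹ * R := mul_le_mul hu.le (hKR x hx) (norm_nonneg x) (by positivity)
    _ = 1 := inv_mul_cancel₀ hR.ne'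

theorem exists_inner_eq [CompleteSpace E] (l : StrongDual ℝ E) : ∃ v : E, ∀ u, l u = inner ℝ u v :=
  ⟨(InnerProductSpace.toDual ℝ E).symm l, fun u => by
    rw [real_inner_comm, InnerProductSpace.toDual_symm_apply]⟩

/-- The bipolar theorem for closed convex sets containing the origin. -/
theorem mem_of_forall_polarSet [CompleteSpace E] {K : Set E} (hc : Convex ℝ K)
    (hcl : IsClosed K) (h0 : (0 : E) ∈ K) {x : E} (hx : ∀ u ∈ polarSet K, inner ℝ u x ≤ 1) :
    x ∈ K := by
  by_contra hxK
  obtain ⟨l, s, hl, hs⟩ := geometric_hahn_banach_closed_point hc hcl hxK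
  obtain ⟨v, hv⟩ := exists_inner_eq l
  have hs0 : 0 < s := by simpa using hl 0 h0
  have hmem : s⁻¹ • v ∈ polarSet K := by
    intro y hy
    have := hl y hy
    rw [hv, real_inner_comm] at this
    rw [real_inner_smul_left, inv_mul_le_iff₀ hs0]
    linarith
  have h := hx _ hmem
  rw [hv, real_inner_comm] at hs
  rw [real_inner_smul_left, inv_mul_le_iff₀ hs0] at h
  linarith

theorem isExposed_polarFace {K : Set E} {x : E} (hx : x ∈ K) :
    IsExposed ℝ (polarSet K) (polarFace K x) := by
  rintro ⟨f, hf⟩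
  refine ⟨innerSL ℝ x, ?_⟩
  simp only [innerSL_apply_apply, real_inner_comm _ x]
  ext u
  refine ⟨fun hu => ⟨hu.1, fun y hy => by rw [hu.2]; exact hy x hx⟩, fun hu => ⟨hu.1, ?_⟩⟩
  have := hu.2 f hf.1
  rw [hf.2] at this
  exact le_antisymm (hu.1 x hx) this

theorem convex_polarFace {K : Set E} {x : E} (hx : x ∈ K) : Convex ℝ (polarFace K x) :=
  (isExposed_polarFace hx).convex (convex_polarSet K)

/-- Half-spaces `⟪·, v⟫ ≤ c` containing the polar come from points of the set. -/
theorem inv_smul_mem_of_forall_polarSet [CompleteSpace E] {K : Set E} (hc : Convex ℝ K)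
    (hcl : IsClosed K) (h0 : (0 : E) ∈ K) {v : E} {c : ℝ} (hc0 : 0 < c)
    (h : ∀ u ∈ polarSet K, inner ℝ u v ≤ c) : c⁻¹ • v ∈ K := by
  refine mem_of_forall_polarSet hc hcl h0 fun u hu => ?_
  rw [real_inner_smul_right, inv_mul_le_iff₀ hc0, mul_one]
  exact h u hu

section ConvexBody

variable [FiniteDimensional ℝ E] {K : Set E}

theorem isProperExposedFace_polarSet_iff (hcomp : IsCompact K) (hconv : Convex ℝ K)
    (h0 : (0 : E) ∈ interior K) {F : Set E} :
    IsProperExposedFace (polarSet K) F ↔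
      ∃ x ∈ K, (polarFace K x).Nonempty ∧ F = polarFace K x := by
  have := FiniteDimensional.complete ℝ E
  constructor
  · rintro ⟨hexp, hne, hneP⟩
    obtain ⟨f, hf⟩ := Set.nonempty_iff_ne_empty.2 hne
    obtain ⟨l, hl⟩ := hexp ⟨f, hf⟩
    obtain ⟨v, hv⟩ := exists_inner_eq l
    simp only [hv] at hl
    have hf' := hf
    rw [hl] at hf'
    have hv0 : v ≠ 0 := by
      rintro rfl
      refine hneP (hl.trans ?_)
      simp
    have hpos : 0 < inner ℝ f v := by
      obtain ⟨ε, hε, hmem⟩ := exists_pos_smul_mem (zero_mem_interior_polarSet hcomp.isBounded) v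
      have h₁ := hf'.2 _ hmem
      rw [real_inner_smul_left] at h₁
      exact lt_of_lt_of_le (mul_pos hε (real_inner_self_pos.2 hv0)) h₁
    have hF : F = polarFace K ((inner ℝ f v : ℝ)⁻¹ • v) := by
      rw [hl]
      ext u
      refine and_congr_right fun hu => ?_
      rw [real_inner_smul_right, inv_mul_eq_one₀ hpos.ne']
      exact ⟨fun h => le_antisymm (h f hf'.1) (hf'.2 u hu), fun h y hy => h ▸ hf'.2 y hy⟩
    exact ⟨_, inv_smul_mem_of_forall_polarSet hconv hcomp.isClosed (interior_subset h0) hpos hf'.2,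
      hF ▸ ⟨f, hf⟩, hF⟩
  · rintro ⟨x, hx, hne, rfl⟩
    refine ⟨isExposed_polarFace hx, hne.ne_empty, fun h => ?_⟩
    have h0P : (0 : E) ∈ polarFace K x :=
      h ▸ interior_subset (zero_mem_interior_polarSet hcomp.isBounded)
    simpa using h0P.2

/-- A nonempty face of the polar other than the polar itself lies in a proper exposed face: it
misses the interior and can be separated from it. -/
theorem IsFace.exists_subset_polarFace (hcomp : IsCompact K) (hconv : Convex ℝ K)
    (h0 : (0 : E) ∈ interior K) {G : Set E} (hG : IsFace (polarSet K) G) (hne : G.Nonempty)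
    (hGP : G ≠ polarSet K) : ∃ x ∈ K, G ⊆ polarFace K x := by
  have := FiniteDimensional.complete ℝ E
  have hP0 := zero_mem_interior_polarSet hcomp.isBounded
  have hdisj : Disjoint (interior (polarSet K)) G := by
    rw [Set.disjoint_left]
    intro g hg hgG
    refine hGP (hG.2.subset.antisymm fun y hy => ?_)
    have hc : Continuous fun t : ℝ => g + t • (g - y) := by fun_prop
    have hev : ∀ᶠ t : ℝ in nhds 0, g + t • (g - y) ∈ polarSet K := by
      refine hc.continuousAt.eventually ?_
      simpa using mem_interior_iff_mem_nhds.1 hg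
    obtain ⟨δ, hδ, h⟩ := Metric.eventually_nhds_iff.1 hev
    have hmem : g + (δ / 2) • (g - y) ∈ polarSet K := by
      refine h ?_
      rw [Real.dist_eq, sub_zero, abs_of_pos (by positivity)]
      linarith
    have hδ' : (1 : ℝ) + δ / 2 ≠ 0 := by positivity
    refine hG.2.left_mem_of_mem_openSegment hy hmem hgG
      ⟨(δ / 2) / (1 + δ / 2), 1 / (1 + δ / 2), by positivity, by positivity, ?_, ?_⟩
    · rw [← add_div, add_comm, div_self hδ']
    · have h₁ : (δ / 2) / (1 + δ / 2) = 1 - 1 / (1 + δ / 2) := by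
        field_simp
        ring
      have h₂ : 1 / (1 + δ / 2) * (δ / 2) = 1 - 1 / (1 + δ / 2) := by
        field_simp
        ring
      rw [smul_add, smul_smul, h₂, h₁]
      module
  obtain ⟨l, c, hl0, hlP, hlG⟩ := geometric_hahn_banach_of_nonempty_interior
    (convex_polarSet K) hG.1 hdisj ⟨0, hP0⟩ hne
  obtain ⟨v, hv⟩ := exists_inner_eq l
  simp only [hv] at hlP hlG
  have hv0 : v ≠ 0 := by
    rintro rfl
    refine hl0 (ContinuousLinearMap.ext fun u => ?_)
    rw [hv]
    simp
  have hpos : 0 < c := by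
    obtain ⟨ε, hε, hmem⟩ := exists_pos_smul_mem hP0 v
    have h₁ := hlP _ hmem
    rw [real_inner_smul_left] at h₁
    exact lt_of_lt_of_le (mul_pos hε (real_inner_self_pos.2 hv0)) h₁
  have hx := inv_smul_mem_of_forall_polarSet hconv hcomp.isClosed (interior_subset h0) hpos hlP
  refine ⟨_, hx, fun g hg => ⟨hG.2.subset hg, le_antisymm (hG.2.subset hg _ hx) ?_⟩⟩
  rw [real_inner_smul_right, le_inv_mul_iff₀ hpos, mul_one]
  exact hlG g hg

end ConvexBody

/-! ### Normal cones as cones over exposed faces of the polar -/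

theorem inner_pos_of_mem_normalCone {K : Set E} (h0 : (0 : E) ∈ interior K) {x u : E}
    (hu : u ∈ normalCone K x) (hu0 : u ≠ 0) : 0 < inner ℝ u x := by
  obtain ⟨ε, hε, hmem⟩ := exists_pos_smul_mem h0 u
  have h := hu _ hmem
  rw [inner_sub_right, real_inner_smul_right] at h
  have := mul_pos hε (real_inner_self_pos.2 hu0)
  linarith

theorem mem_coneOver_polarFace {K : Set E} (h0 : (0 : E) ∈ interior K) {x u : E}
    (hu : u ∈ normalCone K x) (hu0 : u ≠ 0) : u ∈ coneOver (polarFace K x) := by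
  have hpos := inner_pos_of_mem_normalCone h0 hu hu0
  refine ⟨inner ℝ u x, hpos.le, (inner ℝ u x : ℝ)⁻¹ • u, ⟨fun y hy => ?_, ?_⟩, ?_⟩
  · have := hu y hy
    rw [inner_sub_right] at this
    rw [real_inner_smul_left, inv_mul_le_iff₀ hpos]
    linarith
  · rw [real_inner_smul_left, inv_mul_cancel₀ hpos.ne']
  · rw [smul_smul, mul_inv_cancel₀ hpos.ne', one_smul]

/-- A ray from the origin meets the union of all the exposed faces `polarFace K x` at most once. -/
theorem eq_one_of_smul_mem_polarFace {K : Set E} {x y : E} (hx : x ∈ K) (hy : y ∈ K) {t : ℝ}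
    (ht : 0 ≤ t) {f : E} (hf : f ∈ polarFace K y) (htf : t • f ∈ polarFace K x) : t = 1 := by
  have h₁ := htf.1 y hy
  have h₂ := htf.2
  rw [real_inner_smul_left, hf.2, mul_one] at h₁
  rw [real_inner_smul_left] at h₂
  have h₃ := mul_le_mul_of_nonneg_left (hf.1 x hx) ht
  linarith

theorem normalCone_eq_coneOver {K : Set E} (h0 : (0 : E) ∈ interior K) {x : E}
    (hne : (polarFace K x).Nonempty) : normalCone K x = coneOver (polarFace K x) := by
  refine Set.Subset.antisymm (fun u hu => ?_) ?_
  · by_cases hu0 : u = 0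
    · exact hu0 ▸ zero_mem_coneOver hne
    · exact mem_coneOver_polarFace h0 hu hu0
  · rintro _ ⟨t, ht, u, hu, rfl⟩ y hy
    rw [real_inner_smul_left, inner_sub_right, hu.2]
    exact mul_nonpos_of_nonneg_of_nonpos ht (sub_nonpos.2 (hu.1 y hy))

theorem normalCone_eq_zero {K : Set E} (h0 : (0 : E) ∈ interior K) {x : E}
    (hne : ¬ (polarFace K x).Nonempty) : normalCone K x = {0} := by
  refine Set.Subset.antisymm (fun u hu => ?_) ?_
  · by_contra hu0
    obtain ⟨t, -, f, hf, -⟩ := mem_coneOver_polarFace h0 hu hu0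
    exact hne ⟨f, hf⟩
  · rintro _ rfl y _
    simp

theorem normalCone_zero {K : Set E} (h0 : (0 : E) ∈ interior K) : normalCone K 0 = {0} :=
  normalCone_eq_zero h0 fun ⟨f, hf⟩ => by simpa using hf.2

/-- The proper normal cones of a body are its normal cones at those points that cut out a nonempty
exposed face of the polar. -/
theorem isProperNormalCone_iff {K : Set E} (h0 : (0 : E) ∈ interior K) {N : Set E} :
    IsProperNormalCone K N ↔
      ∃ x ∈ K, (polarFace K x).Nonempty ∧ N = normalCone K x := by
  rw [IsProperNormalCone, normalConeOn_empty,
    normalConeOn_eq subset_rfl (interior_subset_intrinsicInterior h0), normalCone_zero h0]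
  constructor
  · rintro ⟨rfl | ⟨x, hx, rfl⟩, hu, hN⟩
    · exact absurd rfl hu
    · refine ⟨x, hx, ?_, rfl⟩
      by_contra hne
      exact hN (normalCone_eq_zero h0 hne)
  · rintro ⟨x, hx, hne, rfl⟩
    refine ⟨Or.inr ⟨x, hx, rfl⟩, ?_, fun h => ?_⟩ <;> rw [normalCone_eq_coneOver h0 hne] at *
    · exact coneOver_ne_univ inner_eq_one_of_mem_polarFace hne
    · obtain ⟨f, hf⟩ := hne
      have hf0 : f = 0 := by simpa [h] using subset_coneOver _ hf
      simpa [hf0] using hf.2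

/-- Faces of the normal cone and faces of the polar correspond by taking cones. -/
theorem isFace_coneOver_iff {K : Set E} {x : E} (hx : x ∈ K) {G : Set E} (hG : G ⊆ polarFace K x)
    (hne : G.Nonempty) :
    IsFace (coneOver (polarFace K x)) (coneOver G) ↔ IsFace (polarSet K) G := by
  have hext := (isExposed_polarFace hx).isExtreme
  constructor
  · intro h
    have h' := h.of_coneOver inner_eq_one_of_mem_polarFace (convex_polarFace hx) hG
    exact ⟨h'.1, hext.trans h'.2⟩
  · intro h
    exact isFace_coneOver inner_eq_one_of_mem_polarFace ⟨h.1, h.2.mono hext.subset hG⟩ hne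

theorem isProperConvexSubset_of_zero_mem_interior [Nontrivial E] {K : Set E}
    (hcomp : IsCompact K) (hconv : Convex ℝ K) (h0 : (0 : E) ∈ interior K) :
    IsProperConvexSubset K := by
  refine ⟨hconv, ⟨0, h0⟩, ?_⟩
  obtain ⟨v, hv⟩ := exists_ne (0 : E)
  have hF : argmaxFace K v = (innerSL ℝ v).toExposed K := by
    simp only [argmaxFace, ContinuousLinearMap.toExposed, innerSL_apply_apply,
      real_inner_comm _ v]
  refine ⟨argmaxFace K v, hF ▸ ContinuousLinearMap.toExposed.isExposed, ?_, fun h => ?_⟩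
  · obtain ⟨x, hx, hmax⟩ := hcomp.exists_isMaxOn ⟨0, interior_subset h0⟩
      (f := fun y => inner ℝ y v) (by fun_prop)
    exact Set.Nonempty.ne_empty ⟨x, hx, hmax⟩
  · have h0F : (0 : E) ∈ argmaxFace K v := h.symm ▸ interior_subset h0
    obtain ⟨ε, hε, hmem⟩ := exists_pos_smul_mem h0 v
    have := h0F.2 _ hmem
    rw [real_inner_smul_left, inner_zero_left] at this
    exact absurd this (not_le.2 (mul_pos hε (real_inner_self_pos.2 hv)))

section ConvexBody

variable [FiniteDimensional ℝ E] {K : Set E}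

theorem forall_isProperNormalCone_iff (hcomp : IsCompact K) (hconv : Convex ℝ K)
    (h0 : (0 : E) ∈ interior K) (Q : Set E → Prop) :
    (∀ N, IsProperNormalCone K N → Q N) ↔
      ∀ F, IsProperExposedFace (polarSet K) F → Q (coneOver F) := by
  simp only [isProperNormalCone_iff h0, isProperExposedFace_polarSet_iff hcomp hconv h0]
  constructor
  · rintro h _ ⟨x, hx, hne, rfl⟩
    exact normalCone_eq_coneOver h0 hne ▸ h _ ⟨x, hx, hne, rfl⟩
  · rintro h _ ⟨x, hx, hne, rfl⟩
    exact normalCone_eq_coneOver h0 hne ▸ h _ ⟨x, hx, hne, rfl⟩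

/-- Exposedness of a part of a proper exposed face of the polar is read off from the cone
over it. -/
theorem coneOver_mem_normalCones_iff (hcomp : IsCompact K) (hconv : Convex ℝ K)
    (h0 : (0 : E) ∈ interior K) {x : E} (hx : x ∈ K) {G : Set E}
    (hG : G ⊆ polarFace K x) (hne : G.Nonempty) :
    coneOver G ∈ normalCones K ↔ IsExposed ℝ (polarSet K) G := by
  have hG1 : ∀ g ∈ G, inner ℝ g x = 1 := fun g hg => (hG hg).2
  constructor
  · rintro (h | ⟨y, hy, h⟩)
    · exact absurd h (coneOver_ne_univ hG1 hne)
    have hyne : (polarFace K y).Nonempty := by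
      by_contra hy'
      rw [normalCone_eq_zero h0 hy'] at h
      obtain ⟨g, hg⟩ := hne
      have hg0 : g = 0 := by simpa [h] using subset_coneOver _ hg
      simpa [hg0] using hG1 g hg
    rw [normalCone_eq_coneOver h0 hyne] at h
    have hGy : G = polarFace K y := by
      refine Set.Subset.antisymm (fun g hg => ?_) (fun f hf => ?_)
      · have hg' : g ∈ coneOver (polarFace K y) := h ▸ subset_coneOver G hg
        obtain ⟨t, ht, f, hf, rfl⟩ := hg'
        rwa [eq_one_of_smul_mem_polarFace hx hy ht hf (hG hg), one_smul]
      · have hf' : f ∈ coneOver G := h ▸ subset_coneOver _ hf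
        obtain ⟨t, ht, g, hg, rfl⟩ := hf'
        rwa [eq_one_of_smul_mem_polarFace hy hx ht (hG hg) hf, one_smul]
    rw [hGy]
    exact isExposed_polarFace hy
  · intro h
    have hprop : IsProperExposedFace (polarSet K) G := by
      refine ⟨h, hne.ne_empty, fun hGP => ?_⟩
      have h0P := interior_subset (zero_mem_interior_polarSet hcomp.isBounded)
      have h1 := hG1 0 (hGP ▸ h0P)
      simp at h1
    obtain ⟨y, hy, hyne, rfl⟩ := (isProperExposedFace_polarSet_iff hcomp hconv h0).1 hprop
    exact Or.inr ⟨y, hy, (normalCone_eq_coneOver h0 hyne).symm⟩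

/-- The exposed rays of a normal cone that are normal cones themselves are spanned by the exposed
points of the polar in the corresponding exposed face. -/
theorem isExposed_ray_and_mem_normalCones_iff (hcomp : IsCompact K) (hconv : Convex ℝ K)
    (h0 : (0 : E) ∈ interior K) {x : E} (hx : x ∈ K) {v : E} (hv : v ≠ 0) :
    (IsExposed ℝ (coneOver (polarFace K x)) (ray v) ∧ ray v ∈ normalCones K) ↔
      ∃ t : ℝ, 0 < t ∧ ∃ p ∈ polarFace K x, v = t • p ∧ p ∈ (polarSet K).exposedPoints ℝ := by
  constructor
  · rintro ⟨hexp, hray⟩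
    obtain ⟨t, ht, p, hp, rfl⟩ := hexp.subset ⟨1, zero_le_one, (one_smul ℝ v).symm⟩
    have ht' : 0 < t := ht.lt_of_ne (by rintro rfl; simp at hv)
    refine ⟨t, ht', p, hp, rfl, ?_⟩
    rw [ray_smul ht', ray_eq_coneOver] at hray
    exact mem_exposedPoints_iff_exposed_singleton.2 ((coneOver_mem_normalCones_iff hcomp hconv h0 hx
      (Set.singleton_subset_iff.2 hp) (Set.singleton_nonempty p)).1 hray)
  · rintro ⟨t, ht, p, hp, rfl, hpe⟩
    have hpF := Set.singleton_subset_iff.2 hp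
    rw [ray_smul ht, ray_eq_coneOver]
    have hmem := (coneOver_mem_normalCones_iff hcomp hconv h0 hx hpF
      (Set.singleton_nonempty p)).2 (mem_exposedPoints_iff_exposed_singleton.1 hpe)
    refine ⟨?_, hmem⟩
    rcases hmem with h | ⟨y, hy, h⟩
    · exact absurd h (coneOver_ne_univ (fun g hg => (hpF hg).2) (Set.singleton_nonempty p))
    · have hle := coneOver_mono hpF
      rw [← normalCone_eq_coneOver h0 ⟨p, hp⟩] at hle ⊢
      rw [h] at hle ⊢
      exact isExposed_normalCone hx hy hle

/-! ### Rays and faces of normal cones against points and faces of the polar -/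

theorem exists_exposed_ray_iff (hcomp : IsCompact K) (hconv : Convex ℝ K)
    (h0 : (0 : E) ∈ interior K) :
    (∀ N, IsProperNormalCone K N → ∃ R, IsRay R ∧ IsExposed ℝ N R ∧ R ∈ normalCones K) ↔
      ∀ F, IsProperExposedFace (polarSet K) F → ∃ x ∈ F, x ∈ (polarSet K).exposedPoints ℝ := by
  rw [forall_isProperNormalCone_iff hcomp hconv h0]
  refine forall₂_congr fun F hF => ?_
  obtain ⟨x, hx, -, rfl⟩ := (isProperExposedFace_polarSet_iff hcomp hconv h0).1 hF
  constructor
  · rintro ⟨_, ⟨v, hv, rfl⟩, h⟩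
    obtain ⟨-, -, p, hp, -, hpe⟩ :=
      (isExposed_ray_and_mem_normalCones_iff hcomp hconv h0 hx hv).1 h
    exact ⟨p, hp, hpe⟩
  · rintro ⟨p, hp, hpe⟩
    have hp0 : p ≠ 0 := by
      rintro rfl
      simpa using hp.2
    exact ⟨ray p, ⟨p, hp0, rfl⟩, (isExposed_ray_and_mem_normalCones_iff hcomp hconv h0 hx hp0).2
      ⟨1, one_pos, p, hp, (one_smul ℝ p).symm, hpe⟩⟩

theorem linearIndependent_exposed_rays_iff (hcomp : IsCompact K) (hconv : Convex ℝ K)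
    (h0 : (0 : E) ∈ interior K) :
    (∀ N, IsProperNormalCone K N → ∃ v : Fin (convexDim N) → E, LinearIndependent ℝ v ∧
        ∀ i, IsExposed ℝ N (ray (v i)) ∧ ray (v i) ∈ normalCones K) ↔
      ∀ F, IsProperExposedFace (polarSet K) F →
        ∃ p : Fin (convexDim F + 1) → E, AffineIndependent ℝ p ∧
          ∀ i, p i ∈ F ∧ p i ∈ (polarSet K).exposedPoints ℝ := by
  rw [forall_isProperNormalCone_iff hcomp hconv h0]
  refine forall₂_congr fun F hF => ?_
  obtain ⟨x, hx, hne, rfl⟩ := (isProperExposedFace_polarSet_iff hcomp hconv h0).1 hF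
  rw [convexDim_coneOver inner_eq_one_of_mem_polarFace hne]
  constructor
  · rintro ⟨v, hv, h⟩
    have h' := fun i =>
      (isExposed_ray_and_mem_normalCones_iff hcomp hconv h0 hx (hv.ne_zero i)).1 (h i)
    choose t ht p hp hvp hpe using h'
    refine ⟨p, ?_, fun i => ⟨hp i, hpe i⟩⟩
    rw [affineIndependent_iff_linearIndependent_of_inner_eq_one fun i => (hp i).2,
      ← LinearIndependent.units_smul_iff p fun i => Units.mk0 (t i) (ht i).ne']
    convert! hv using 1
    ext1 i
    rw [hvp i]
    rfl
  · rintro ⟨p, hp, h⟩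
    rw [affineIndependent_iff_linearIndependent_of_inner_eq_one fun i => (h i).1.2] at hp
    exact ⟨p, hp, fun i =>
      (isExposed_ray_and_mem_normalCones_iff hcomp hconv h0 hx (hp.ne_zero i)).2
        ⟨1, one_pos, p i, (h i).1, (one_smul ℝ _).symm, (h i).2⟩⟩

theorem extreme_rays_mem_normalCones_iff (hcomp : IsCompact K) (hconv : Convex ℝ K)
    (h0 : (0 : E) ∈ interior K) :
    (∀ N, IsProperNormalCone K N → ∀ R, IsRay R → IsFace N R → R ∈ normalCones K) ↔
      ¬ ∃ x, IsNonExposedPoint (polarSet K) x := by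
  rw [forall_isProperNormalCone_iff hcomp hconv h0]
  constructor
  · rintro h ⟨p, hp, hpn⟩
    have hne := Set.singleton_nonempty p
    obtain ⟨x, hx, hpx⟩ := hp.exists_subset_polarFace hcomp hconv h0 hne
      fun hP => hpn (hP ▸ IsExposed.refl _)
    refine hpn ((coneOver_mem_normalCones_iff hcomp hconv h0 hx hpx hne).1 ?_)
    have hp1 := Set.singleton_subset_iff.1 hpx
    have hp0 : p ≠ 0 := by
      rintro rfl
      simpa using hp1.2
    exact h _ ((isProperExposedFace_polarSet_iff hcomp hconv h0).2 ⟨x, hx, ⟨p, hp1⟩, rfl⟩) _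
      ⟨p, hp0, (ray_eq_coneOver p).symm⟩ ((isFace_coneOver_iff hx hpx hne).2 hp)
  · rintro h F hF _ ⟨v, hv, rfl⟩ hface
    obtain ⟨x, hx, -, rfl⟩ := (isProperExposedFace_polarSet_iff hcomp hconv h0).1 hF
    obtain ⟨t, ht, p, hp, rfl⟩ := hface.2.subset ⟨1, zero_le_one, (one_smul ℝ v).symm⟩
    have ht' : 0 < t := ht.lt_of_ne (by rintro rfl; simp at hv)
    have hpF := Set.singleton_subset_iff.2 hp
    have hne := Set.singleton_nonempty p
    rw [ray_smul ht', ray_eq_coneOver] at hface ⊢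
    rw [isFace_coneOver_iff hx hpF hne] at hface
    rw [coneOver_mem_normalCones_iff hcomp hconv h0 hx hpF hne]
    by_contra hpn
    exact h ⟨p, hface, hpn⟩

theorem faces_mem_normalCones_iff (hcomp : IsCompact K) (hconv : Convex ℝ K)
    (h0 : (0 : E) ∈ interior K) :
    (∀ N, IsProperNormalCone K N → ∀ T, T.Nonempty → IsFace N T → T ∈ normalCones K) ↔
      ¬ ∃ F, IsNonExposedFace (polarSet K) F := by
  rw [forall_isProperNormalCone_iff hcomp hconv h0]
  constructor
  · rintro h ⟨G, hG, hGn⟩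
    have hne : G.Nonempty := by
      rw [Set.nonempty_iff_ne_empty]
      rintro rfl
      exact hGn isExposed_empty
    obtain ⟨x, hx, hGx⟩ := hG.exists_subset_polarFace hcomp hconv h0 hne
      fun hP => hGn (hP ▸ IsExposed.refl _)
    refine hGn ((coneOver_mem_normalCones_iff hcomp hconv h0 hx hGx hne).1 ?_)
    exact h _ ((isProperExposedFace_polarSet_iff hcomp hconv h0).2 ⟨x, hx, hne.mono hGx, rfl⟩) _
      ⟨0, zero_mem_coneOver hne⟩ ((isFace_coneOver_iff hx hGx hne).2 hG)
  · intro h F hF T hT hface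
    obtain ⟨x, hx, -, rfl⟩ := (isProperExposedFace_polarSet_iff hcomp hconv h0).1 hF
    rcases hface.eq_zero_or_inter_nonempty hT with rfl | hne
    · exact Or.inr ⟨0, interior_subset h0, (normalCone_zero h0).symm⟩
    · have hTeq := hface.eq_coneOver_inter hne
      rw [hTeq] at hface ⊢
      rw [isFace_coneOver_iff hx Set.inter_subset_right hne] at hface
      rw [coneOver_mem_normalCones_iff hcomp hconv h0 hx Set.inter_subset_right hne]
      by_contra hn
      exact h ⟨_, hface, hn⟩

theorem normalCones_eq_touchingCones_iff (hconv : Convex ℝ K) (h0 : (0 : E) ∈ interior K) :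
    normalCones K = touchingCones K ↔
      ∀ N, IsProperNormalCone K N → ∀ T, T.Nonempty → IsFace N T → T ∈ normalCones K := by
  simp only [isProperNormalCone_iff h0]
  constructor
  · rintro h _ ⟨x, hx, -, rfl⟩ T hT hface
    rw [h, mem_touchingCones_iff hconv]
    exact Or.inr ⟨hT, x, hx, hface⟩
  · intro h
    refine (normalCones_subset_touchingCones hconv).antisymm fun T hT => ?_
    rcases (mem_touchingCones_iff hconv).1 hT with rfl | ⟨hTne, x, hx, hface⟩
    · exact Or.inl rfl
    · by_cases hne : (polarFace K x).Nonempty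
      · exact h _ ⟨x, hx, hne, rfl⟩ T hTne hface
      · have hN := normalCone_eq_zero h0 hne
        have hT0 : T = normalCone K x := by
          rw [hN] at hface ⊢
          exact hTne.subset_singleton_iff.1 hface.2.subset
        exact Or.inr ⟨x, hx, hT0⟩

end ConvexBody

end ConvexPolar

theorem mainTheorem5 (m : ℕ) (hm : 1 ≤ m) (K : Set (EuclideanSpace ℝ (Fin m)))
    (hKcompact : IsCompact K) (hKconvex : Convex ℝ K) (hK0 : 0 ∈ interior K) :
    (K ∈ classC0 m ↔
      ∀ F, IsProperExposedFace (polarSet K) F → ∃ x ∈ F, x ∈ (polarSet K).exposedPoints ℝ) ∧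
    (K ∈ classC m ↔
      ∀ F, IsProperExposedFace (polarSet K) F →
        ∃ p : Fin (convexDim F + 1) → EuclideanSpace ℝ (Fin m), AffineIndependent ℝ p ∧
          ∀ i, p i ∈ F ∧ p i ∈ (polarSet K).exposedPoints ℝ) ∧
    (K ∈ classC' m ↔ ¬ ∃ x, IsNonExposedPoint (polarSet K) x) ∧
    (K ∈ classC'' m ↔ ¬ ∃ F, IsNonExposedFace (polarSet K) F) ∧
    ((¬ ∃ F, IsNonExposedFace (polarSet K) F) ↔ normalCones K = touchingCones K) := by
  have : Nonempty (Fin m) := ⟨⟨0, hm⟩⟩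
  have hprop := isProperConvexSubset_of_zero_mem_interior hKcompact hKconvex hK0
  have hfaces := faces_mem_normalCones_iff hKcompact hKconvex hK0
  exact ⟨(and_iff_right hprop).trans (exists_exposed_ray_iff hKcompact hKconvex hK0),
    (and_iff_right hprop).trans (linearIndependent_exposed_rays_iff hKcompact hKconvex hK0),
    (and_iff_right hprop).trans (extreme_rays_mem_normalCones_iff hKcompact hKconvex hK0),
    (and_iff_right hprop).trans hfaces,
    hfaces.symm.trans (normalCones_eq_touchingCones_iff hKconvex hK0).symm⟩
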